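/- Let $\mathcal M=(S,S_\Box,S_\bigcirc,\longrightarrow,P)$ be a finitely branching countable Markov decision process: $S$ is a countable set of states, partitioned into player states $S_\Box$ and random states $S_\bigcirc$; $\longrightarrow\;\subseteq S\times S$ is a transition relation such that every state has at least one and only finitely many successors; and $P$ assigns to each random state a probability distribution on its successors. A strategy $\sigma$ assigns to each history $w s\in S^*S_\Box$ a probability distribution on the successors of $s$; it is MD (memoryless deterministic) if this distribution depends only on $s$ and is always a Dirac distribution. Let $\mathcal P_{\mathcal M,s,\sigma}$ be the probability measure on infinite sequences of states induced by the initial state $s$ and the strategy $\sigma$. Let $\mathit{Col}:S\to\{0,1\}$ be a color function and let $\varphi$ be the $\{0,1\}$-parity (co-Büchi) objective, i.e. the set of all sequences $s_0s_1s_2\cdots$ such that the largest color occurring infinitely often among $\mathit{Col}(s_0),\mathit{Col}(s_1),\dots$ is even. Put $\mathrm{val}_{\mathcal M}(s)=\sup_\sigma \mathcal P_{\mathcal M,s,\sigma}(\varphi)$, the supremum being over all strategies. Then for every $\varepsilon>0$ there is an MD strategy $\sigma$ that is $\varepsilon$-optimal from every state, that is, $$\mathcal P_{\mathcal M,s,\sigma}(\varphi)\;\ge\;\mathrm{val}_{\mathcal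 M}(s)-\varepsilon\qquad\text{for all } s\in S.$$ -/

import Mathlib

open MeasureTheory ProbabilityTheory Filter

/-- A Markov decision process with state space `S` (assumed countable in the theorem).  The states
in `player` belong to the player, all other states are random; `step s t` means that `t` is a
successor of `s`.  Every state has a successor, and every random state carries a probability
distribution on its successors. -/
structure MDP (S : Type*) where
  player : Set S
  step : S → S → Prop
  exists_step : ∀ s, ∃ t, step s t
  prob : {s : S // s ∉ player} → PMF S
  step_of_mem_support : ∀ s t, t ∈ (prob s).support → step s t

namespace MDP

variable {S : Type*}

/-- Every state has only finitely many successors. -/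
def FinitelyBranching (M : MDP S) : Prop :=
  ∀ s, {t | M.step s t}.Finite

/-- A (history-dependent, randomized) strategy: `act w s` is the distribution on successors that
is chosen after the history `w s`, where `w` lists the states visited before the current player
state `s`, the oldest first. -/
structure Strategy (M : MDP S) where
  act : List S → M.player → PMF S
  step_of_mem_support : ∀ w s t, t ∈ (act w s).support → M.step s t

/-- The choice depends on the current state only. -/
def Strategy.IsMemoryless {M : MDP S} (σ : M.Strategy) : Prop :=
  ∃ f : M.player → PMF S, ∀ w s, σ.act w s = f s

/-- All choices are Dirac distributions. -/
def Strategy.IsDeterministic {M : MDP S} (σ : M.Strategy) : Prop :=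
  ∀ w s, ∃ t, σ.act w s = PMF.pure t

/-- Memoryless deterministic strategies. -/
def Strategy.IsMD {M : MDP S} (σ : M.Strategy) : Prop :=
  σ.IsMemoryless ∧ σ.IsDeterministic

open Classical in
/-- The distribution of the next state after the history `w s`: that of the strategy in a player
state, that of the MDP in a random state. -/
noncomputable def Strategy.next {M : MDP S} (σ : M.Strategy) (w : List S) (s : S) : PMF S :=
  if h : s ∈ M.player then σ.act w ⟨s, h⟩ else M.prob ⟨s, h⟩

section Measure

variable [Countable S] [MeasurableSpace S] [DiscreteMeasurableSpace S]

/-- The transition kernel from the states at times `0, …, n` to the state at time `n + 1`. -/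
noncomputable def Strategy.kernel {M : MDP S} (σ : M.Strategy) (n : ℕ) :
    Kernel ((i : Finset.Iic n) → (fun _ : ℕ => S) i) S where
  toFun h := (σ.next
    (List.ofFn fun i : Fin n => h ⟨i, Finset.mem_Iic.2 i.isLt.le⟩)
    (h ⟨n, Finset.mem_Iic.2 le_rfl⟩)).toMeasure
  measurable' := measurable_of_countable _

instance {M : MDP S} (σ : M.Strategy) (n : ℕ) : IsMarkovKernel (σ.kernel n) where
  isProbabilityMeasure _ := PMF.toMeasure.isProbabilityMeasure (σ.next _ _)

/-- The probability measure on infinite sequences of states that is induced by the strategy `σ`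
and the initial state `s₀`, given by the Ionescu-Tulcea extension of the kernels above. -/
noncomputable def Strategy.measure {M : MDP S} (σ : M.Strategy) (s₀ : S) : Measure (ℕ → S) :=
  Kernel.traj (X := fun _ => S) σ.kernel 0 (fun _ => s₀)

/-- The value of the state `s` for the objective `φ`. -/
noncomputable def value (M : MDP S) (φ : Set (ℕ → S)) (s : S) : ℝ :=
  ⨆ σ : M.Strategy, (σ.measure s).real φ

/-- `σ` is `ε`-optimal from the state `s` for the objective `φ`. -/
def Strategy.IsEpsOptimal {M : MDP S} (σ : M.Strategy) (φ : Set (ℕ → S)) (ε : ℝ) (s : S) : Prop :=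
  (σ.measure s).real φ ≥ M.value φ s - ε

end Measure

end MDP

/-- The parity objective: some even color occurs infinitely often, and from some time on no
larger color occurs. -/
def parity {S : Type*} (col : S → ℕ) : Set (ℕ → S) :=
  {w | ∃ i : ℕ, (∃ᶠ n in atTop, col (w n) = 2 * i) ∧ ∀ᶠ n in atTop, col (w n) ≤ 2 * i}

/-! With colors 0 and 1 the objective says that `B`, the set of states of color 1, is visited only
finitely often. Let `b x` be the least probability of ever visiting `B` from `x`. As branching is
finite, one selector `τ` attains it everywhere. Fix a small `γ` and put `δ = 1 - γ`.

Upper bound: under any strategy, `B` or `{b ≤ γ}` is almost surely visited again after every time,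
so a play that leaves `B` forever almost surely meets `{b ≤ γ}`. Hence the value is at most the
optimal probability `V` of reaching `{b ≤ γ}` (`after_eventuallyAvoid_le`, resting on
`one_le_of_minimal`).

Lower bound: commit to `τ` on `{b ≤ γ}`, leave the other states free, and take a selector `σ` that
is near-optimal from all states at once for reaching the safer set `{b ≤ γ * γ}`
(`exists_uniform_selector`). The commitment is cheap: from `{b ≤ γ}`, `τ` almost surely reaches `{b
≤ γ * γ}` or `B`, hence the former with probability at least `δ`. It also keeps `σ` safe: under `σ`,
`B` is hit with probability at most `b / γ`, which is at most `γ` on `{b ≤ γ * γ}`. So `σ` succeeds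
with probability at least `δ ^ 3 * V` (`exists_switching_selector`, `le_after_eventuallyAvoid`). -/

open scoped ENNReal

/-! ### Means under discrete distributions -/

namespace PMF

variable {S : Type*}

/-- The mean of a nonnegative function under a discrete distribution. -/
noncomputable def mean (p : PMF S) (f : S → ℝ≥0∞) : ℝ≥0∞ :=
  ∑' y, p y * f y

lemma mean_mono (p : PMF S) {f g : S → ℝ≥0∞} (h : f ≤ g) : p.mean f ≤ p.mean g :=
  ENNReal.tsum_le_tsum fun y => by gcongr; exact h y

lemma mean_le_mean_of_support (p : PMF S) {f g : S → ℝ≥0∞} (h : ∀ y ∈ p.support, f y ≤ g y) :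
    p.mean f ≤ p.mean g := by
  refine ENNReal.tsum_le_tsum fun y => ?_
  by_cases hy : p y = 0
  · simp [hy]
  · gcongr
    exact h y ((p.mem_support_iff y).2 hy)

lemma mean_add (p : PMF S) (f g : S → ℝ≥0∞) :
    p.mean (fun y => f y + g y) = p.mean f + p.mean g := by
  simp only [mean, mul_add, ENNReal.tsum_add]

lemma mean_const_mul (p : PMF S) (c : ℝ≥0∞) (f : S → ℝ≥0∞) :
    p.mean (fun y => c * f y) = c * p.mean f := by
  simp only [mean, mul_left_comm _ c, ENNReal.tsum_mul_left]

@[simp]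
lemma mean_const (p : PMF S) (c : ℝ≥0∞) : p.mean (fun _ => c) = c := by
  simp [mean, ENNReal.tsum_mul_right, p.tsum_coe]

@[simp]
lemma mean_pure (t : S) (f : S → ℝ≥0∞) : (PMF.pure t).mean f = f t := by
  classical
  rw [mean, tsum_eq_single t fun y hy => by simp [hy]]
  simp

lemma mean_iSup (p : PMF S) {f : ℕ → S → ℝ≥0∞} (hf : Monotone f) :
    p.mean (fun y => ⨆ n, f n y) = ⨆ n, p.mean (f n) := by
  simp only [mean, ENNReal.tsum_eq_iSup_sum, ENNReal.mul_iSup]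
  rw [iSup_comm]
  refine iSup_congr fun s => ?_
  exact ENNReal.finsetSum_iSup_of_monotone fun y m n h => by gcongr; exact hf h y

end PMF

/-! ### Reachability values as least fixed points -/

namespace Reach

variable {S : Type*} (K : S → S → PMF S)

open Classical in
/-- One step of value iteration for reaching `T`, discounted by `l`, where in `x` the choices in
`C x` are allowed and `t` leads to the distribution `K x t`. -/
noncomputable def stepMap (l : ℝ≥0∞) (T : Set S) (C : S → Set S) : (S → ℝ≥0∞) →o (S → ℝ≥0∞) where
  toFun f x := if x ∈ T then 1 else l * ⨆ t ∈ C x, (K x t).mean f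
  monotone' f g h x := by
    dsimp only
    split_ifs
    · rfl
    · gcongr
      exact PMF.mean_mono _ h

lemma stepMap_of_mem {l : ℝ≥0∞} {T : Set S} {C : S → Set S} {f : S → ℝ≥0∞} {x : S} (hx : x ∈ T) :
    stepMap K l T C f x = 1 :=
  if_pos hx

lemma stepMap_of_notMem {l : ℝ≥0∞} {T : Set S} {C : S → Set S} {f : S → ℝ≥0∞} {x : S}
    (hx : x ∉ T) : stepMap K l T C f x = l * ⨆ t ∈ C x, (K x t).mean f :=
  if_neg hx

/-- The optimal `l`-discounted probability to reach `T` with the choices allowed by `C`. -/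
noncomputable def value (l : ℝ≥0∞) (T : Set S) (C : S → Set S) : S → ℝ≥0∞ :=
  (stepMap K l T C).lfp

variable {K} {l : ℝ≥0∞} {T : Set S} {C D : S → Set S}

lemma value_of_mem {x : S} (hx : x ∈ T) : value K l T C x = 1 := by
  rw [value, ← OrderHom.map_lfp, stepMap_of_mem K hx]

lemma value_of_notMem {x : S} (hx : x ∉ T) :
    value K l T C x = l * ⨆ t ∈ C x, (K x t).mean (value K l T C) := by
  conv_lhs => rw [value, ← OrderHom.map_lfp, stepMap_of_notMem K hx]
  rfl

lemma value_singleton_of_notMem {x : S} {τ : S → S} (hx : x ∉ T) :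
    value K 1 T (fun y => {τ y}) x = (K x (τ x)).mean (value K 1 T fun y => {τ y}) := by
  rw [value_of_notMem hx]
  simp

lemma value_le {f : S → ℝ≥0∞} (h1 : ∀ x ∈ T, 1 ≤ f x)
    (h2 : ∀ x ∉ T, ∀ t ∈ C x, l * (K x t).mean f ≤ f x) : value K l T C ≤ f := by
  refine OrderHom.lfp_le _ fun x => ?_
  by_cases hx : x ∈ T
  · simpa [stepMap_of_mem K hx] using h1 x hx
  · simpa [stepMap_of_notMem K hx, ENNReal.mul_iSup] using h2 x hx

lemma mean_value_le {x t : S} (hx : x ∉ T) (ht : t ∈ C x) :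
    (K x t).mean (value K 1 T C) ≤ value K 1 T C x := by
  rw [value_of_notMem hx, one_mul]
  exact le_iSup₂ (f := fun t _ => (K x t).mean (value K 1 T C)) t ht

lemma value_le_one (hl : l ≤ 1) (x : S) : value K l T C x ≤ 1 :=
  value_le (f := fun _ => 1) (fun _ _ => le_rfl) (fun _ _ _ _ => by simpa using hl) x

lemma value_ne_top (hl : l ≤ 1) (x : S) : value K l T C x ≠ ∞ :=
  ((value_le_one hl x).trans_lt ENNReal.one_lt_top).ne

lemma value_mono {l' : ℝ≥0∞} (hl : l ≤ l') (h : ∀ x, C x ⊆ D x) :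
    value K l T C ≤ value K l' T D := by
  refine value_le (fun x hx => (value_of_mem hx).ge) fun x hx t ht => ?_
  rw [value_of_notMem hx]
  gcongr
  exact le_iSup₂ (f := fun t _ => (K x t).mean (value K l' T D)) t (h x ht)

/-- Induction along value iteration, for affine lower bounds. -/
lemma add_mul_value_le {g : S → ℝ≥0∞} {a c : ℝ≥0∞} (h0 : ∀ x, a ≤ g x)
    (h1 : ∀ x ∈ T, a + c ≤ g x)
    (h2 : ∀ f : S → ℝ≥0∞, f ≤ value K l T C → (∀ x, a + c * f x ≤ g x) → ∀ x ∉ T,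
      a + c * (l * ⨆ t ∈ C x, (K x t).mean f) ≤ g x) (x : S) :
    a + c * value K l T C x ≤ g x := by
  suffices h : ∀ x, a + c * (stepMap K l T C).lfp x ≤ g x from h x
  refine OrderHom.lfp_induction (p := fun f : S → ℝ≥0∞ => ∀ x, a + c * f x ≤ g x) _ ?_ ?_
  · intro f hf hle x
    by_cases hx : x ∈ T
    · simpa [stepMap_of_mem K hx] using h1 x hx
    · simpa [stepMap_of_notMem K hx] using h2 f hle hf x hx
  · intro s hs x
    rcases s.eq_empty_or_nonempty with rfl | ⟨f₀, hf₀⟩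
    · simpa using h0 x
    · have : Nonempty s := ⟨⟨f₀, hf₀⟩⟩
      rw [sSup_apply, ENNReal.mul_iSup, ENNReal.add_iSup]
      exact iSup_le fun f => hs f.1 f.2 x

/-! ### Uniformly near-optimal selectors for reachability -/

lemma exists_argmax (hn : ∀ x, (C x).Nonempty) (hf : ∀ x, (C x).Finite) (f : S → ℝ≥0∞) :
    ∃ τ : S → S, (∀ x, τ x ∈ C x) ∧ ∀ x, ∀ t ∈ C x, (K x t).mean f ≤ (K x (τ x)).mean f := by
  have h := fun x => Set.exists_max_image (C x) (fun t => (K x t).mean f) (hf x) (hn x)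
  choose τ h1 h2 using h
  exact ⟨τ, h1, h2⟩

lemma exists_argmin (hn : ∀ x, (C x).Nonempty) (hf : ∀ x, (C x).Finite) (f : S → ℝ≥0∞) :
    ∃ τ : S → S, (∀ x, τ x ∈ C x) ∧ ∀ x, ∀ t ∈ C x, (K x (τ x)).mean f ≤ (K x t).mean f := by
  have h := fun x => Set.exists_min_image (C x) (fun t => (K x t).mean f) (hf x) (hn x)
  choose τ h1 h2 using h
  exact ⟨τ, h1, h2⟩

/-- A discounted value is attained by a selector. -/
lemma exists_value_discount_le (hn : ∀ x, (C x).Nonempty) (hf : ∀ x, (C x).Finite) (hl : l < 1) :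
    ∃ τ : S → S, (∀ x, τ x ∈ C x) ∧ value K l T C ≤ value K 1 T fun x => {τ x} := by
  obtain ⟨τ, h1, h2⟩ := exists_argmax (K := K) hn hf (value K l T C)
  refine ⟨τ, h1, fun x => ?_⟩
  -- Each step along the greedy `τ` multiplies the possible deficit by `l`.
  have key : ∀ n : ℕ, ∀ x, value K l T C x ≤ value K 1 T (fun x => {τ x}) x + l ^ n := by
    intro n
    induction n with
    | zero => exact fun x => (value_le_one hl.le x).trans (by simp)
    | succ n ih =>
      intro x
      by_cases hx : x ∈ T
      · simp [value_of_mem hx]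
      · rw [value_of_notMem hx, value_singleton_of_notMem hx]
        calc l * ⨆ t ∈ C x, (K x t).mean (value K l T C)
            ≤ l * (K x (τ x)).mean (fun y => value K 1 T (fun x => {τ x}) y + l ^ n) := by
              gcongr
              exact iSup₂_le fun t ht => (h2 x t ht).trans (PMF.mean_mono _ ih)
          _ = l * (K x (τ x)).mean (value K 1 T fun x => {τ x}) + l ^ (n + 1) := by
              rw [PMF.mean_add, PMF.mean_const, mul_add, pow_succ']
          _ ≤ _ := by
              gcongr
              exact mul_le_of_le_one_left' hl.le
  have ht := (ENNReal.tendsto_pow_atTop_nhds_zero_of_lt_one hl).const_add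
    (value K 1 T (fun x => {τ x}) x)
  rw [add_zero] at ht
  exact ge_of_tendsto' ht fun n => key n x

lemma value_le_iSup_discount {r : ℕ → ℝ≥0∞} (hr : Monotone r) (h1 : ⨆ n, r n = 1) :
    value K 1 T C ≤ fun x => ⨆ n, value K (r n) T C x := by
  have hm : Monotone fun n => value K (r n) T C := fun m n h => value_mono (hr h) fun _ => le_rfl
  refine value_le (fun x hx => ?_) fun x hx t ht => ?_
  · simp [value_of_mem hx]
  · rw [PMF.mean_iSup _ hm, ← h1, ENNReal.iSup_mul, iSup_le_iff]
    intro m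
    rw [ENNReal.mul_iSup, iSup_le_iff]
    intro n
    refine le_iSup_of_le (max m n) ?_
    rw [value_of_notMem hx]
    refine mul_le_mul' (hr (le_max_left _ _)) ?_
    exact (PMF.mean_mono _ (hm (le_max_right m n))).trans
      (le_iSup₂ (f := fun t _ => (K x t).mean (value K (r (max m n)) T C)) t ht)

/-- Discounted values increase to the undiscounted one as the discount tends to 1, so at the single
state `s` some discount already exceeds the fraction `κ`, and a discounted value is attained by a
selector. -/
lemma exists_selector_at (hn : ∀ x, (C x).Nonempty) (hf : ∀ x, (C x).Finite) {κ : ℝ≥0∞}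
    (hκ : κ < 1) (s : S) :
    ∃ τ : S → S, (∀ x, τ x ∈ C x) ∧ κ * value K 1 T C s ≤ value K 1 T (fun x => {τ x}) s := by
  obtain ⟨r, hr, hr1, hrt⟩ := exists_seq_strictMono_tendsto' (zero_lt_one' ℝ≥0∞)
  have hsup : ⨆ n, r n = 1 := iSup_eq_of_tendsto hr.monotone hrt
  rcases eq_or_ne (value K 1 T C s) 0 with h0 | h0
  · obtain ⟨τ, h1, -⟩ := exists_argmax (K := K) hn hf 0
    exact ⟨τ, h1, by simp [h0]⟩
  have hlt : κ * value K 1 T C s < ⨆ n, value K (r n) T C s := by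
    refine lt_of_lt_of_le ?_ (value_le_iSup_discount hr.monotone hsup s)
    calc κ * value K 1 T C s < 1 * value K 1 T C s :=
          ENNReal.mul_lt_mul_left h0 (value_ne_top le_rfl s) hκ
      _ = _ := one_mul _
  obtain ⟨n, hnlt⟩ := lt_iSup_iff.1 hlt
  obtain ⟨τ, h1, h2⟩ := exists_value_discount_le (K := K) (T := T) hn hf (hr1 n).2
  exact ⟨τ, h1, hnlt.le.trans (h2 s)⟩

/-- Fixing the choices of a selector that is nearly optimal in `s` wherever it is nearly optimal
makes every remaining selector nearly optimal in `s`, at a small loss of value elsewhere. -/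
lemma exists_restriction (hn : ∀ x, (C x).Nonempty) (hf : ∀ x, (C x).Finite) {κ : ℝ≥0∞}
    (hκ : κ < 1) (s : S) :
    ∃ C' : S → Set S, (∀ x, C' x ⊆ C x) ∧ (∀ x, (C' x).Nonempty) ∧
      (∀ x, κ * value K 1 T C x ≤ value K 1 T C' x) ∧
      (∀ σ : S → S, (∀ x, σ x ∈ C' x) →
        κ * value K 1 T C s ≤ value K 1 T (fun x => {σ x}) s) ∧
      ∃ t, C' s = {t} := by
  classical
  obtain ⟨e, he⟩ := exists_add_of_le hκ.le
  have he0 : e ≠ 0 := fun h => hκ.ne (by rw [he, h, add_zero])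
  have he1 : e ≤ 1 := he ▸ le_add_self
  have het : e ≠ ∞ := (he1.trans_lt ENNReal.one_lt_top).ne
  have hκt : κ ≠ ∞ := (hκ.trans ENNReal.one_lt_top).ne
  -- Here `e = 1 - κ`. Demanding the factor `κ + e * κ` at `s` leaves exactly `e * κ` once `κ * u s`
  -- is subtracted in the last part.
  have hlt : κ + e * κ < 1 := by
    conv_rhs => rw [he]
    refine (ENNReal.add_lt_add_iff_left hκt).2 ?_
    calc e * κ < e * 1 := ENNReal.mul_lt_mul_right he0 het hκ
      _ = e := mul_one e
  obtain ⟨τ, hτ, hs⟩ := exists_selector_at (K := K) (T := T) hn hf hlt s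
  set w := value K 1 T fun x => {τ x}
  set u := value K 1 T C
  have hsG : κ * u s ≤ w s := le_trans (by gcongr; exact le_self_add) hs
  let C' : S → Set S := fun x => if κ * u x ≤ w x then {τ x} else C x
  have hτ' : ∀ x, τ x ∈ C' x := fun x => by
    by_cases h : κ * u x ≤ w x <;> simp [C', h, hτ]
  refine ⟨C', fun x => ?_, fun x => ⟨_, hτ' x⟩, ?_, ?_, τ s, by simp [C', hsG]⟩
  · by_cases h : κ * u x ≤ w x <;> simp [C', h, hτ]
  · have hw : w ≤ value K 1 T C' := value_mono le_rfl (by simpa using hτ')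
    intro x
    have := add_mul_value_le (K := K) (l := 1) (T := T) (C := C) (g := value K 1 T C') (a := 0)
      (c := κ) (by simp) (fun x hx => by simpa [value_of_mem hx] using hκ.le) (fun f hfu ih x hx => ?_) x
    · simpa using this
    simp only [zero_add, one_mul] at ih ⊢
    by_cases h : κ * u x ≤ w x
    · refine le_trans ?_ (h.trans (hw x))
      gcongr
      exact iSup₂_le fun t ht => (PMF.mean_mono _ hfu).trans (mean_value_le hx ht)
    · rw [ENNReal.mul_iSup]
      refine iSup_le fun t => ?_
      rw [ENNReal.mul_iSup]
      refine iSup_le fun ht => ?_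
      rw [← PMF.mean_const_mul]
      exact (PMF.mean_mono _ ih).trans (mean_value_le hx (by simpa [C', h] using ht))
  · intro σ hσ
    -- Follow `τ`: while `κ * u ≤ w` holds, `σ` makes the same moves; where it fails, `w` is below
    -- `κ * u`. So all but `κ * u` of `w` is accounted for by `σ`.
    have key : ∀ x, 0 + 1 * w x ≤ e * value K 1 T (fun x => {σ x}) x + κ * u x := by
      refine add_mul_value_le (by simp) (fun x hx => ?_) fun f hfw ih x hx => ?_
      · simp [u, value_of_mem hx, he ▸ (add_comm κ e).le]
      · simp only [Set.mem_singleton_iff, iSup_iSup_eq_left, zero_add, one_mul] at ih ⊢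
        by_cases h : κ * u x ≤ w x
        · have hστ : σ x = τ x := by simpa [C', h] using hσ x
          rw [value_singleton_of_notMem hx, hστ]
          refine (PMF.mean_mono _ ih).trans ?_
          rw [PMF.mean_add, PMF.mean_const_mul, PMF.mean_const_mul]
          gcongr
          exact mean_value_le hx (hτ x)
        · refine le_trans ?_ ((not_le.1 h).le.trans le_add_self)
          exact (PMF.mean_mono _ hfw).trans (value_singleton_of_notMem hx).ge
    have h := hs.trans ((by simp : w s ≤ 0 + 1 * w s).trans (key s))
    rw [add_mul, add_comm, mul_assoc] at h
    exact (ENNReal.mul_le_mul_iff_right he0 het).1 ((ENNReal.add_le_add_iff_right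
      (ENNReal.mul_ne_top hκt (value_ne_top le_rfl s))).1 h)

/-- **Ornstein's theorem** for finitely many choices: some selector is multiplicatively
near-optimal for reaching `T` from all states simultaneously. -/
theorem exists_uniform_selector [Countable S] (hn : ∀ x, (C x).Nonempty)
    (hf : ∀ x, (C x).Finite) {κ : ℝ≥0∞} (hκ : κ < 1) :
    ∃ σ : S → S, (∀ x, σ x ∈ C x) ∧
      ∀ x, κ * value K 1 T C x ≤ value K 1 T (fun x => {σ x}) x := by
  rcases isEmpty_or_nonempty S with hS | hS
  · exact ⟨id, fun x => hS.elim x, fun x => hS.elim x⟩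
  obtain ⟨s, hs⟩ := exists_surjective_nat S
  have hκt : κ ≠ ∞ := (hκ.trans ENNReal.one_lt_top).ne
  -- The budget starts at `c 0 = 1` and decreases strictly towards `κ`. Stage `i` may lose the
  -- factor `c (i + 1) / c i`, and these factors telescope.
  let c : ℕ → ℝ≥0∞ := fun i => κ + (1 - κ) * 2⁻¹ ^ i
  have hc0 : ∀ i, c i ≠ 0 := fun i => by
    have : (1 - κ) * 2⁻¹ ^ i ≠ 0 := mul_ne_zero (tsub_pos_of_lt hκ).ne' (by simp)
    simp [c, this]
  have hct : ∀ i, c i ≠ ∞ := fun i => by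
    refine ENNReal.add_ne_top.2 ⟨hκt, ENNReal.mul_ne_top (by simp) (ENNReal.pow_ne_top (by simp))⟩
  have hc : ∀ i, c (i + 1) / c i < 1 := fun i => by
    rw [ENNReal.div_lt_iff (Or.inl (hc0 i)) (Or.inl (hct i)), one_mul]
    refine (ENNReal.add_lt_add_iff_left hκt).2 ?_
    refine ENNReal.mul_lt_mul_right (tsub_pos_of_lt hκ).ne' (by simp) ?_
    rw [pow_succ]
    calc (2⁻¹ : ℝ≥0∞) ^ i * 2⁻¹ < 2⁻¹ ^ i * 1 :=
          ENNReal.mul_lt_mul_right (by simp) (ENNReal.pow_ne_top (by simp))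
            (by simp)
      _ = _ := mul_one _
  let 𝒞 := {C : S → Set S // ∀ x, (C x).Nonempty ∧ (C x).Finite}
  have step : ∀ (C : 𝒞) (i : ℕ), ∃ C' : 𝒞, (∀ x, C'.1 x ⊆ C.1 x) ∧
      (∀ x, c (i + 1) / c i * value K 1 T C.1 x ≤ value K 1 T C'.1 x) ∧
      (∀ σ : S → S, (∀ x, σ x ∈ C'.1 x) →
        c (i + 1) / c i * value K 1 T C.1 (s i) ≤ value K 1 T (fun x => {σ x}) (s i)) ∧
      ∃ t, C'.1 (s i) = {t} := by
    intro C i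
    obtain ⟨C', h1, h2, h3⟩ := exists_restriction (K := K) (T := T) (fun x => (C.2 x).1)
      (fun x => (C.2 x).2) (hc i) (s i)
    exact ⟨⟨C', fun x => ⟨h2 x, (C.2 x).2.subset (h1 x)⟩⟩, h1, h3⟩
  choose next hsub hval hsel hsing using step
  let 𝒮 : ℕ → 𝒞 := fun n => Nat.rec ⟨C, fun x => ⟨hn x, hf x⟩⟩ (fun i C => next C i) n
  have hanti : ∀ x, Antitone fun n => (𝒮 n).1 x := fun x =>
    antitone_nat_of_succ_le fun n => hsub (𝒮 n) n x
  have hvalue : ∀ n x, c n * value K 1 T C x ≤ value K 1 T (𝒮 n).1 x := by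
    intro n
    induction n with
    | zero => exact fun x => by simp [c, 𝒮, add_tsub_cancel_of_le hκ.le]
    | succ n ih =>
      intro x
      refine le_trans ?_ (hval (𝒮 n) n x)
      calc c (n + 1) * value K 1 T C x = c (n + 1) / c n * (c n * value K 1 T C x) := by
            rw [← mul_assoc, ENNReal.div_mul_cancel (hc0 n) (hct n)]
        _ ≤ _ := by gcongr; exact ih x
  choose i hi using hs
  choose t ht using fun x => hsing (𝒮 (i x)) (i x)
  -- The choice at `x` becomes unique at stage `i x + 1`. Earlier choice sets contain it, and later
  -- ones are nonempty subsets of that singleton.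
  have hσ : ∀ n x, t x ∈ (𝒮 n).1 x := by
    intro n x
    rcases le_total n (i x + 1) with h | h
    · exact hanti x h (by have := ht x; rw [hi] at this; change t x ∈ (next _ _).1 x; rw [this]; rfl)
    · obtain ⟨y, hy⟩ := ((𝒮 n).2 x).1
      have h1 : y ∈ (next (𝒮 (i x)) (i x)).1 x := hanti x h hy
      have h2 := ht x
      rw [hi] at h2
      rw [h2] at h1
      rwa [← Set.mem_singleton_iff.1 h1]
  refine ⟨t, hσ 0, fun x => ?_⟩
  have h1 := hsel (𝒮 (i x)) (i x) t (hσ (i x + 1))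
  rw [hi] at h1
  refine le_trans ?_ h1
  calc κ * value K 1 T C x ≤ c (i x + 1) * value K 1 T C x := by gcongr; exact le_self_add
    _ = c (i x + 1) / c (i x) * (c (i x) * value K 1 T C x) := by
      rw [← mul_assoc, ENNReal.div_mul_cancel (hc0 _) (hct _)]
    _ ≤ _ := by gcongr; exact hvalue _ x

/-! ### Avoiding `B`, and switching between safety and reachability -/

variable {B : Set S}

/-- A selector that minimizes the probability to reach `B`, from all states simultaneously. -/
lemma exists_safe_selector (hn : ∀ x, (C x).Nonempty) (hf : ∀ x, (C x).Finite) :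
    ∃ τ : S → S, (∀ x, τ x ∈ C x) ∧ ∀ f : S → ℝ≥0∞, (∀ x ∈ B, 1 ≤ f x) →
      (∀ x ∉ B, ∃ t ∈ C x, (K x t).mean f ≤ f x) → value K 1 B (fun x => {τ x}) ≤ f := by
  -- The choice that minimizes the mean of `b` makes `b` itself superharmonic, since `b` lies below
  -- every competitor.
  let b : S → ℝ≥0∞ := sInf {f | (∀ x ∈ B, 1 ≤ f x) ∧ ∀ x ∉ B, ∃ t ∈ C x, (K x t).mean f ≤ f x}
  have hb : ∀ f : S → ℝ≥0∞, (∀ x ∈ B, 1 ≤ f x) →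
      (∀ x ∉ B, ∃ t ∈ C x, (K x t).mean f ≤ f x) → b ≤ f := fun f h1 h2 => sInf_le ⟨h1, h2⟩
  obtain ⟨τ, hτ, hmin⟩ := exists_argmin (K := K) hn hf b
  refine ⟨τ, hτ, fun f h1 h2 => le_trans (value_le ?_ ?_) (hb f h1 h2)⟩
  · intro x hx
    simp only [b, sInf_apply]
    exact le_iInf fun g => g.2.1 x hx
  · rintro x hx _ rfl
    rw [one_mul]
    conv_rhs => simp only [b, sInf_apply]
    refine le_iInf fun g => ?_
    obtain ⟨t, ht, hle⟩ := g.2.2 x hx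
    exact (hmin x t ht).trans ((PMF.mean_mono _ (hb g g.2.1 g.2.2)).trans hle)

/-- Suppose that `b` is the least probability to reach `B`. If `H ≤ 1` is `1` on `B` and on
`{b ≤ θ}`, and is elsewhere at least its mean under some choice, then `H` is `1` everywhere. -/
lemma one_le_of_minimal (hn : ∀ x, (C x).Nonempty) {b H : S → ℝ≥0∞} {θ : ℝ≥0∞} (hθ0 : θ ≠ 0) (hθ1 : θ ≤ 1)
    (hb : ∀ f : S → ℝ≥0∞, (∀ x ∈ B, 1 ≤ f x) →
      (∀ x ∉ B, ∃ t ∈ C x, (K x t).mean f ≤ f x) → b ≤ f)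
    (hH1 : ∀ x, H x ≤ 1) (hB : ∀ x ∈ B, 1 ≤ H x) (hT : ∀ x, b x ≤ θ → 1 ≤ H x)
    (hH : ∀ x, 1 ≤ H x ∨ ∃ t ∈ C x, (K x t).mean H ≤ H x) (x : S) : 1 ≤ H x := by
  obtain ⟨η, hη⟩ := exists_add_of_le hθ1
  have hη1 : η < 1 := by
    have hηt : η ≠ ∞ := ((hη ▸ le_add_self : η ≤ 1).trans_lt ENNReal.one_lt_top).ne
    conv_rhs => rw [hη, add_comm]
    exact ENNReal.lt_add_right hηt hθ0
  have contract : ∀ e : ℝ≥0∞, e ≠ 0 → e ≤ 1 → (∀ x, 1 ≤ H x + e) → ∀ x, 1 ≤ H x + e * η := by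
    intro e he0 he1 he x
    have het : e ≠ ∞ := (he1.trans_lt ENNReal.one_lt_top).ne
    -- The affine stretching of `H` that fixes 1 and sends `1 - e` to 0 is again a competitor, so `b
    -- ≤ f`. Where `b > θ` this improves the bound `H ≥ 1 - e` to `H ≥ 1 - e * (1 - θ)`.
    let f : S → ℝ≥0∞ := fun x => (H x + e - 1) / e
    have hfe : ∀ x, e * f x + 1 = H x + e := fun x => by
      rw [ENNReal.mul_div_cancel he0 het, tsub_add_cancel_of_le (he x)]
    have h1 : ∀ x, 1 ≤ H x → 1 ≤ f x := fun x hx => by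
      rw [ENNReal.le_div_iff_mul_le (Or.inl he0) (Or.inl het), one_mul, add_comm,
        ENNReal.le_sub_iff_add_le_left (by simp) (le_add_left hx)]
      rw [add_comm]
      gcongr
    have hbf : b ≤ f := by
      refine hb f (fun x hx => h1 x (hB x hx)) fun x hx => ?_
      have hex : ∃ t ∈ C x, (K x t).mean H ≤ H x := by
        obtain ⟨t, ht⟩ := hn x
        refine (hH x).elim (fun h => ⟨t, ht, ?_⟩) id
        exact ((PMF.mean_mono _ hH1).trans (PMF.mean_const _ 1).le).trans h
      obtain ⟨t, ht, hle⟩ := hex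
      refine ⟨t, ht, ?_⟩
      have h2 : e * (K x t).mean f + 1 ≤ e * f x + 1 := by
        rw [hfe, ← PMF.mean_const_mul, ← PMF.mean_const (K x t) 1, ← PMF.mean_add]
        simp only [PMF.mean_const, hfe, PMF.mean_add]
        gcongr
      exact (ENNReal.mul_le_mul_iff_right he0 het).1
        ((ENNReal.add_le_add_iff_right ENNReal.one_ne_top).1 h2)
    by_cases hx : b x ≤ θ
    · exact (hT x hx).trans le_self_add
    · have h3 : e * θ + 1 ≤ e * θ + (H x + e * η) := by
        calc e * θ + 1 ≤ e * f x + 1 := by gcongr; exact (not_le.1 hx).le.trans (hbf x)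
          _ = H x + e * (θ + η) := by rw [hfe, ← hη, mul_one]
          _ = _ := by ring
      exact (ENNReal.add_le_add_iff_left
        (ENNReal.mul_ne_top het (hθ1.trans_lt ENNReal.one_lt_top).ne)).1 h3
  rcases ne_or_eq η 0 with hη0 | hη0
  · have key : ∀ n : ℕ, ∀ x, 1 ≤ H x + η ^ n := by
      intro n
      induction n with
      | zero => exact fun x => by simp
      | succ n ih => exact pow_succ η n ▸ contract _ (pow_ne_zero n hη0) (pow_le_one' hη1.le n) ih
    have ht := (ENNReal.tendsto_pow_atTop_nhds_zero_of_lt_one hη1).const_add (H x)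
    rw [add_zero] at ht
    exact ge_of_tendsto' ht fun n => key n x
  -- If `θ = 1`, the powers of `η` are no longer admissible errors, but a single contraction from
  -- error 1 suffices.
  · simpa [hη0] using contract 1 one_ne_zero le_rfl (fun x => le_add_self) x

/-- Following a safe selector in the states from which `B` can be avoided with high probability,
and a uniformly good selector towards even safer states elsewhere. -/
theorem exists_switching_selector [Countable S] (hn : ∀ x, (C x).Nonempty)
    (hf : ∀ x, (C x).Finite) {γ δ κ : ℝ≥0∞} (hγ : γ ≠ 0) (hγδ : γ + δ = 1) (hκ : κ < 1) :
    ∃ (b : S → ℝ≥0∞) (σ : S → S), (∀ x, σ x ∈ C x) ∧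
      (∀ f : S → ℝ≥0∞, (∀ x ∈ B, 1 ≤ f x) →
        (∀ x ∉ B, ∃ t ∈ C x, (K x t).mean f ≤ f x) → b ≤ f) ∧
      (∀ x, γ * value K 1 B (fun x => {σ x}) x ≤ b x) ∧
      ∀ x, κ * (δ * value K 1 {x | b x ≤ γ} C x) ≤
        value K 1 {x | b x ≤ γ * γ} (fun x => {σ x}) x := by
  classical
  have hγ1 : γ ≤ 1 := hγδ ▸ le_self_add
  have hδ1 : δ ≤ 1 := hγδ ▸ le_add_self
  have hγγ : γ * γ ≤ γ := mul_le_of_le_one_left' hγ1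
  have hγt : γ ≠ ∞ := (hγ1.trans_lt ENNReal.one_lt_top).ne
  obtain ⟨τ, hτ, hb⟩ := exists_safe_selector (K := K) (B := B) hn hf
  set b := value K 1 B fun x => {τ x}
  let C' : S → Set S := fun x => if b x ≤ γ then {τ x} else C x
  have hτ' : ∀ x, τ x ∈ C' x := fun x => by
    by_cases h : b x ≤ γ <;> simp [C', h, hτ]
  have hC' : ∀ x, C' x ⊆ C x := fun x => by
    by_cases h : b x ≤ γ <;> simp [C', h, hτ]
  obtain ⟨σ, hσ, hσv⟩ := exists_uniform_selector (K := K) (T := {x | b x ≤ γ * γ})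
    (fun x => ⟨_, hτ' x⟩) (fun x => (hf x).subset (hC' x)) hκ
  refine ⟨b, σ, fun x => hC' x (hσ x), hb, fun x => ?_, fun x => ?_⟩
  · have := add_mul_value_le (K := K) (l := 1) (T := B) (C := fun x => {σ x}) (g := b) (a := 0)
      (c := γ) (by simp) (fun x hx => by simpa [b, value_of_mem hx] using hγ1)
      (fun f hfv ih x hx => ?_) x
    · simpa using this
    simp only [Set.mem_singleton_iff, iSup_iSup_eq_left, zero_add, one_mul] at ih ⊢
    -- Where `b ≤ γ`, `σ` agrees with `τ`, for which `b` is superharmonic off `B`; elsewhere the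
    -- trivial bound `γ * 1 < b` is enough.
    by_cases h : b x ≤ γ
    · have hστ : σ x = τ x := by simpa [C', h] using hσ x
      rw [← PMF.mean_const_mul, hστ]
      exact (PMF.mean_mono _ ih).trans (mean_value_le hx rfl)
    · calc γ * (K x (σ x)).mean f ≤ γ * (K x (σ x)).mean (fun _ => 1) := by
            gcongr
            exact PMF.mean_mono _ fun y => (hfv y).trans (value_le_one le_rfl y)
        _ ≤ b x := by simpa using (not_le.1 h).le
  · refine le_trans ?_ (hσv x)
    gcongr
    set T := {x | b x ≤ γ * γ}
    -- Under `τ`, the play almost surely reaches `T` or `B`. The truncation at 1 only serves the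
    -- hypothesis `H ≤ 1` of `one_le_of_minimal`.
    have hit : ∀ x, 1 ≤ min 1 (value K 1 T (fun x => {τ x}) x + b x) := by
      refine one_le_of_minimal (K := K) (B := B) (b := b) (θ := γ * γ) hn (mul_ne_zero hγ hγ)
        (hγγ.trans hγ1) hb (fun x => min_le_left _ _) (fun x hx => ?_) (fun x hx => ?_) fun x => ?_
      · simp [b, value_of_mem hx]
      · simp [value_of_mem (K := K) (l := 1) (C := fun x => {τ x}) (T := T) hx]
      · by_cases hT : x ∈ T
        · exact Or.inl (by simp [value_of_mem hT])
        by_cases hB : x ∈ B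
        · exact Or.inl (by simp [b, value_of_mem hB])
        · refine Or.inr ⟨τ x, hτ x, le_min ?_ ?_⟩
          · exact (PMF.mean_mono _ fun y => min_le_left _ _).trans (PMF.mean_const _ 1).le
          · refine (PMF.mean_mono _ fun y => min_le_right _ _).trans ?_
            rw [PMF.mean_add]
            exact add_le_add (mean_value_le hT rfl) (mean_value_le hB rfl)
    have hτv : value K 1 T (fun x => {τ x}) ≤ value K 1 T C' :=
      value_mono le_rfl (by simpa using hτ')
    have hδ : ∀ x, b x ≤ γ → δ ≤ value K 1 T C' x := fun x hx => by
      have h1 := ((add_comm δ γ).trans hγδ).le.trans ((hit x).trans (min_le_right _ _))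
      exact (ENNReal.add_le_add_iff_right hγt).1 (h1.trans (add_le_add (hτv x) hx))
    have := add_mul_value_le (K := K) (l := 1) (T := {x | b x ≤ γ}) (C := C)
      (g := value K 1 T C') (a := 0) (c := δ) (by simp) (fun x hx => by simpa using hδ x hx)
      (fun f hfv ih x hx => ?_) x
    · simpa using this
    simp only [zero_add, one_mul] at ih ⊢
    have hxT : x ∉ T := fun h => hx (le_trans h hγγ)
    rw [ENNReal.mul_iSup]
    refine iSup_le fun t => ?_
    rw [ENNReal.mul_iSup]
    refine iSup_le fun ht => ?_
    rw [← PMF.mean_const_mul]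
    exact (PMF.mean_mono _ ih).trans (mean_value_le hxT
      (by simpa [C', show ¬ b x ≤ γ from hx] using ht))

end Reach

/-! ### Strategies and their one-step laws -/

namespace MDP

variable {S : Type*} {M : MDP S}

open Classical in
/-- The distribution of the next state if the player chooses `t` in `x`. -/
noncomputable def law (M : MDP S) (x t : S) : PMF S :=
  if h : x ∈ M.player then PMF.pure t else M.prob ⟨x, h⟩

/-- Randomizing averages over successors, so it cannot beat the best one. At a random state the
chosen `t` is a dummy: `law` ignores it. -/
lemma Strategy.mean_next_le (σ : M.Strategy) (w : List S) (x : S) (f : S → ℝ≥0∞) :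
    (σ.next w x).mean f ≤ ⨆ t ∈ {t | M.step x t}, (M.law x t).mean f := by
  by_cases hx : x ∈ M.player
  · simp only [next, law, hx, dite_true, PMF.mean_pure]
    refine (PMF.mean_le_mean_of_support _ (g := fun _ => ⨆ t ∈ {t | M.step x t}, f t)
      fun y hy => ?_).trans (PMF.mean_const _ _).le
    exact le_iSup₂ (f := fun t _ => f t) y (σ.step_of_mem_support w ⟨x, hx⟩ y hy)
  · obtain ⟨t, ht⟩ := M.exists_step x
    refine le_trans ?_ (le_iSup₂ (f := fun t _ => (M.law x t).mean f) t ht)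
    simp [next, law, hx]

lemma Strategy.iInf_le_mean_next (σ : M.Strategy) (w : List S) (x : S) (f : S → ℝ≥0∞) :
    ⨅ t ∈ {t | M.step x t}, (M.law x t).mean f ≤ (σ.next w x).mean f := by
  by_cases hx : x ∈ M.player
  · simp only [next, law, hx, dite_true, PMF.mean_pure]
    refine (PMF.mean_const (σ.act w ⟨x, hx⟩) _).ge.trans
      (PMF.mean_le_mean_of_support _ fun y hy => ?_)
    exact iInf₂_le (f := fun t _ => f t) y (σ.step_of_mem_support w ⟨x, hx⟩ y hy)
  · obtain ⟨t, ht⟩ := M.exists_step x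
    refine le_trans (iInf₂_le (f := fun t _ => (M.law x t).mean f) t ht) ?_
    simp [next, law, hx]

/-- The memoryless deterministic strategy given by a choice of successors. -/
noncomputable def Strategy.ofChoice (τ : S → S) (hτ : ∀ x, M.step x (τ x)) : M.Strategy where
  act _ s := PMF.pure (τ s)
  step_of_mem_support w s t ht := by
    rw [PMF.support_pure, Set.mem_singleton_iff] at ht
    exact ht ▸ hτ s

lemma Strategy.isMD_ofChoice (τ : S → S) (hτ : ∀ x, M.step x (τ x)) : (ofChoice τ hτ).IsMD :=
  ⟨⟨fun s => PMF.pure (τ s), fun _ _ => rfl⟩, fun _ s => ⟨τ s, rfl⟩⟩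

lemma Strategy.next_ofChoice (τ : S → S) (hτ : ∀ x, M.step x (τ x)) (w : List S) (x : S) :
    (ofChoice τ hτ).next w x = M.law x (τ x) :=
  rfl

lemma nonempty_strategy (M : MDP S) : Nonempty M.Strategy := by
  choose τ hτ using M.exists_step
  exact ⟨Strategy.ofChoice τ hτ⟩

/-! ### Play measures and the events of hitting and avoiding a set -/

section Measure

variable [Countable S] [MeasurableSpace S] [DiscreteMeasurableSpace S]

/-- The law of the play under `σ` after the history `h` of length `n + 1`. -/
noncomputable def Strategy.after (σ : M.Strategy) (n : ℕ)
    (h : (i : Finset.Iic n) → (fun _ : ℕ => S) i) : Measure (ℕ → S) :=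
  Kernel.traj (X := fun _ => S) σ.kernel n h

instance (σ : M.Strategy) (n : ℕ) (h : (i : Finset.Iic n) → (fun _ : ℕ => S) i) :
    IsProbabilityMeasure (σ.after n h) :=
  inferInstanceAs (IsProbabilityMeasure (Kernel.traj (X := fun _ => S) σ.kernel n h))

/-- The last state of a history. -/
def last {n : ℕ} (h : (i : Finset.Iic n) → (fun _ : ℕ => S) i) : S :=
  h ⟨n, Finset.mem_Iic.2 le_rfl⟩

lemma Strategy.after_last (σ : M.Strategy) (n : ℕ)
    (h : (i : Finset.Iic n) → (fun _ : ℕ => S) i) : ∀ᵐ w ∂σ.after n h, w n = last h := by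
  have h1 : (σ.after n h).map (Preorder.frestrictLe (π := fun _ => S) n) = Measure.dirac h := by
    rw [after, Kernel.traj_map_frestrictLe_apply, Kernel.partialTraj_self, Kernel.id_apply]
  have h2 : ∀ᵐ g ∂(σ.after n h).map (Preorder.frestrictLe (π := fun _ => S) n), g = h := by
    rw [h1, ae_dirac_eq]
    rfl
  have h3 := ae_of_ae_map (by fun_prop) h2
  filter_upwards [h3] with w hw
  exact congrFun hw ⟨n, Finset.mem_Iic.2 le_rfl⟩

/-- The history `h` followed by `y`. -/
def extend {n : ℕ} (h : (i : Finset.Iic n) → (fun _ : ℕ => S) i) (y : S) :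
    (i : Finset.Iic (n + 1)) → (fun _ : ℕ => S) i :=
  IicProdIoc (X := fun _ => S) n (n + 1) (h, MeasurableEquiv.piSingleton (X := fun _ => S) n y)

omit [Countable S] [DiscreteMeasurableSpace S] in
lemma last_extend {n : ℕ} (h : (i : Finset.Iic n) → (fun _ : ℕ => S) i) (y : S) :
    last (extend h y) = y := by
  simp [last, extend, IicProdIoc, MeasurableEquiv.piSingleton]

/-- The states of a history before the last one. -/
def past {n : ℕ} (h : (i : Finset.Iic n) → (fun _ : ℕ => S) i) : List S :=
  List.ofFn fun i : Fin n => h ⟨i, Finset.mem_Iic.2 i.isLt.le⟩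

/-- The one-step Markov property. Plays keep their full history, so the event is not shifted. -/
lemma Strategy.after_eq_mean (σ : M.Strategy) (n : ℕ)
    (h : (i : Finset.Iic n) → (fun _ : ℕ => S) i) {E : Set (ℕ → S)} (hE : MeasurableSet E) :
    σ.after n h E =
      (σ.next (past h) (last h)).mean fun y => σ.after (n + 1) (extend h y) E := by
  have hκ : IsMarkovKernel ((σ.kernel n).map (MeasurableEquiv.piSingleton (X := fun _ => S) n)) :=
    Kernel.IsMarkovKernel.map _ (MeasurableEquiv.measurable _)
  rw [after, ← Kernel.traj_comp_partialTraj (Nat.le_succ n), Kernel.comp_apply' _ _ _ hE,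
    Nat.succ_eq_add_one, Kernel.partialTraj_succ_self,
    Kernel.lintegral_map _ (by fun_prop) _ (Kernel.measurable_coe _ hE),
    Kernel.lintegral_id_prod, Kernel.lintegral_map]
  · rw [lintegral_countable']
    refine tsum_congr fun y => ?_
    rw [mul_comm]
    congr 1
    exact PMF.toMeasure_apply_singleton _ _ (measurableSet_singleton y)
  all_goals fun_prop


/-- The plays that visit `A` at time `n` or later. -/
def hitFrom (A : Set S) (n : ℕ) : Set (ℕ → S) :=
  {w | ∃ i ≥ n, w i ∈ A}

/-- The plays that visit `A` only finitely often. -/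
def eventuallyAvoid (A : Set S) : Set (ℕ → S) :=
  {w | ∃ n, ∀ i ≥ n, w i ∉ A}

omit [Countable S] in
lemma measurableSet_coord (A : Set S) (i : ℕ) : MeasurableSet {w : ℕ → S | w i ∈ A} :=
  measurable_pi_apply i (MeasurableSet.of_discrete (s := A))

omit [Countable S] in
lemma measurableSet_hitFrom (A : Set S) (n : ℕ) : MeasurableSet (hitFrom A n) := by
  simp only [hitFrom, Set.ofPred_exists, Set.ofPred_and]
  exact .iUnion fun i => .inter (.const _) (measurableSet_coord A i)

omit [Countable S] in
lemma measurableSet_eventuallyAvoid (A : Set S) : MeasurableSet (eventuallyAvoid A) := by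
  simp only [eventuallyAvoid, Set.ofPred_exists, Set.ofPred_forall]
  exact .iUnion fun n => .iInter fun i => .iInter fun _ => (measurableSet_coord A i).compl

/-- The probability to hit `A` is bounded by the value of any reachability problem whose choices
are at least as good as the steps of `σ`. -/
lemma Strategy.after_hitFrom_le (σ : M.Strategy) {C : S → Set S}
    (hσ : ∀ w x f, (σ.next w x).mean f ≤ ⨆ t ∈ C x, (M.law x t).mean f) (A : Set S) (n : ℕ)
    (h : (i : Finset.Iic n) → (fun _ : ℕ => S) i) :
    σ.after n h (hitFrom A n) ≤ Reach.value M.law 1 A C (last h) := by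
  -- Bounded horizons allow induction; `n` and `h` vary because each step lengthens the history.
  have key : ∀ (k n : ℕ) (h : (i : Finset.Iic n) → (fun _ : ℕ => S) i),
      σ.after n h {w | ∃ i, n ≤ i ∧ i < n + k ∧ w i ∈ A} ≤ Reach.value M.law 1 A C (last h) := by
    intro k
    induction k with
    | zero =>
      intro n h
      have : {w : ℕ → S | ∃ i, n ≤ i ∧ i < n + 0 ∧ w i ∈ A} = ∅ := by
        ext w
        simp only [Set.mem_ofPred_eq, Set.mem_empty_iff_false, iff_false]
        rintro ⟨i, h1, h2, -⟩
        omega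
      rw [this]
      simp
    | succ k ih =>
      intro n h
      by_cases hA : last h ∈ A
      · rw [Reach.value_of_mem hA]
        exact prob_le_one
      have hm : MeasurableSet {w : ℕ → S | ∃ i, n + 1 ≤ i ∧ i < n + 1 + k ∧ w i ∈ A} := by
        simp only [Set.ofPred_exists, Set.ofPred_and]
        exact .iUnion fun i => .inter (.const _) (.inter (.const _) (measurableSet_coord A i))
      calc σ.after n h {w | ∃ i, n ≤ i ∧ i < n + (k + 1) ∧ w i ∈ A}
          ≤ σ.after n h {w | ∃ i, n + 1 ≤ i ∧ i < n + 1 + k ∧ w i ∈ A} := by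
            refine measure_mono_ae ?_
            filter_upwards [σ.after_last n h] with w hw
            rintro ⟨i, h1, h2, h3⟩
            have hin : i ≠ n := by
              rintro rfl
              exact hA (hw ▸ h3)
            exact ⟨i, by omega, by omega, h3⟩
        _ ≤ (σ.next (past h) (last h)).mean (Reach.value M.law 1 A C) := by
            rw [σ.after_eq_mean n h hm]
            refine PMF.mean_mono _ fun y => (ih (n + 1) (extend h y)).trans ?_
            rw [last_extend]
        _ ≤ _ := by
            rw [Reach.value_of_notMem hA, one_mul]
            exact hσ _ _ _
  have hU : hitFrom A n = ⋃ k, {w : ℕ → S | ∃ i, n ≤ i ∧ i < n + k ∧ w i ∈ A} := by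
    ext w
    simp only [hitFrom, Set.mem_ofPred_eq, Set.mem_iUnion]
    constructor
    · rintro ⟨i, h1, h2⟩
      exact ⟨i + 1, i, h1, by omega, h2⟩
    · rintro ⟨k, i, h1, -, h2⟩
      exact ⟨i, h1, h2⟩
  rw [hU, Monotone.measure_iUnion]
  · exact iSup_le fun k => key k n h
  · rintro k l hkl w ⟨i, h1, h2, h3⟩
    exact ⟨i, h1, by omega, h3⟩

/-- The infimum over all strategies and all histories ending in `x` of the probability to visit
`A` from now on. -/
noncomputable def infHit (M : MDP S) (A : Set S) (x : S) : ℝ≥0∞ :=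
  ⨅ (σ : M.Strategy) (n : ℕ) (h : (i : Finset.Iic n) → (fun _ : ℕ => S) i) (_ : last h = x),
    σ.after n h (hitFrom A n)

lemma infHit_le (σ : M.Strategy) (A : Set S) (n : ℕ)
    (h : (i : Finset.Iic n) → (fun _ : ℕ => S) i) :
    M.infHit A (last h) ≤ σ.after n h (hitFrom A n) :=
  iInf_le_of_le σ (iInf_le_of_le n (iInf_le_of_le h (iInf_le _ rfl)))

lemma infHit_le_one (A : Set S) (x : S) : M.infHit A x ≤ 1 := by
  obtain ⟨σ⟩ := nonempty_strategy M
  exact (infHit_le σ A 0 (fun _ => x)).trans prob_le_one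

lemma one_le_infHit {A : Set S} {x : S} (hx : x ∈ A) : 1 ≤ M.infHit A x := by
  refine le_iInf fun σ => le_iInf fun n => le_iInf fun h => le_iInf fun hh => ?_
  rw [← measure_univ (μ := σ.after n h)]
  refine measure_mono_ae ?_
  filter_upwards [σ.after_last n h] with w hw _
  exact ⟨n, le_rfl, by rwa [hw, hh]⟩

/-- Taking the infimum over histories as well as strategies makes the hitting probability a function
of the state alone, to which `one_le_of_minimal` applies. -/
lemma exists_mean_infHit_le (hM : M.FinitelyBranching) (A : Set S) (x : S) :
    ∃ t ∈ {t | M.step x t}, (M.law x t).mean (M.infHit A) ≤ M.infHit A x := by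
  obtain ⟨τ, hτ, hmin⟩ := Reach.exists_argmin (K := M.law) M.exists_step hM (M.infHit A)
  refine ⟨τ x, hτ x, ?_⟩
  refine le_iInf fun σ => le_iInf fun n => le_iInf fun h => le_iInf fun hh => ?_
  subst hh
  calc (M.law (last h) (τ (last h))).mean (M.infHit A)
      ≤ ⨅ t ∈ {t | M.step (last h) t}, (M.law (last h) t).mean (M.infHit A) :=
        le_iInf₂ (hmin (last h))
    _ ≤ (σ.next (past h) (last h)).mean (M.infHit A) := σ.iInf_le_mean_next _ _ _
    _ ≤ σ.after n h (hitFrom A n) := by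
        rw [σ.after_eq_mean n h (measurableSet_hitFrom A n)]
        refine PMF.mean_mono _ fun y => ?_
        have := infHit_le σ A (n + 1) (extend h y)
        rw [last_extend] at this
        refine this.trans (measure_mono ?_)
        rintro w ⟨i, hi, hw⟩
        exact ⟨i, by omega, hw⟩

/-- As `A` is hit almost surely after every history, averaging over `k` further steps shows that it
is hit after any later time too. -/
lemma Strategy.after_hitFrom_add_eq_one (σ : M.Strategy) {A : Set S}
    (hA : ∀ n (h : (i : Finset.Iic n) → (fun _ : ℕ => S) i), 1 ≤ σ.after n h (hitFrom A n))
    (k n : ℕ) (h : (i : Finset.Iic n) → (fun _ : ℕ => S) i) :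
    σ.after n h (hitFrom A (n + k)) = 1 := by
  induction k generalizing n with
  | zero => exact le_antisymm prob_le_one (hA n h)
  | succ k ih =>
    rw [σ.after_eq_mean n h (measurableSet_hitFrom A _), show n + (k + 1) = n + 1 + k by omega]
    simp [ih]

/-- Almost every play that visits `B` only finitely often visits the states from which `B` can be
avoided with probability at least `1 - γ`. -/
lemma Strategy.after_eventuallyAvoid_le (hM : M.FinitelyBranching) (σ : M.Strategy) {B : Set S}
    {b : S → ℝ≥0∞} {γ : ℝ≥0∞} (hγ0 : γ ≠ 0) (hγ1 : γ ≤ 1)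
    (hb : ∀ f : S → ℝ≥0∞, (∀ x ∈ B, 1 ≤ f x) →
      (∀ x ∉ B, ∃ t ∈ {t | M.step x t}, (M.law x t).mean f ≤ f x) → b ≤ f)
    (h : (i : Finset.Iic 0) → (fun _ : ℕ => S) i) :
    σ.after 0 h (eventuallyAvoid B) ≤
      Reach.value M.law 1 {x | b x ≤ γ} (fun x => {t | M.step x t}) (last h) := by
  set T := {x | b x ≤ γ}
  have h1 : ∀ x, 1 ≤ M.infHit (T ∪ B) x :=
    Reach.one_le_of_minimal (K := M.law) M.exists_step hγ0 hγ1 hb (infHit_le_one _)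
      (fun x hx => one_le_infHit (Or.inr hx)) (fun x hx => one_le_infHit (Or.inl hx))
      fun x => Or.inr (exists_mean_infHit_le hM _ x)
  have h2 : ∀ n, ∀ᵐ w ∂σ.after 0 h, w ∈ hitFrom (T ∪ B) n := fun n => by
    have := σ.after_hitFrom_add_eq_one (fun n h => (h1 _).trans (infHit_le σ _ n h)) n 0 h
    rw [zero_add] at this
    exact (prob_compl_eq_zero_iff (measurableSet_hitFrom _ _)).2 this
  refine le_trans (measure_mono_ae ?_) (σ.after_hitFrom_le (σ.mean_next_le) T 0 h)
  filter_upwards [ae_all_iff.2 h2] with w hw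
  rintro ⟨n, hn⟩
  obtain ⟨i, hi, hiT | hiB⟩ := hw n
  · exact ⟨i, Nat.zero_le i, hiT⟩
  · exact absurd hiB (hn i hi)

/-- If `B` is avoided with probability at least `δ` from all states in `T`, then the probability to
visit `B` only finitely often is at least `δ` times the probability to reach `T`. -/
lemma Strategy.le_after_eventuallyAvoid {τ : S → S} (hτ : ∀ x, M.step x (τ x)) {B T : Set S}
    {γ δ : ℝ≥0∞} (hγδ : γ + δ = 1)
    (hT : ∀ x ∈ T, Reach.value M.law 1 B (fun x => {τ x}) x ≤ γ) (n : ℕ)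
    (h : (i : Finset.Iic n) → (fun _ : ℕ => S) i) :
    δ * Reach.value M.law 1 T (fun x => {τ x}) (last h) ≤
      (ofChoice τ hτ).after n h (eventuallyAvoid B) := by
  set σ := ofChoice τ hτ
  have hγt : γ ≠ ∞ := ((hγδ ▸ le_self_add : γ ≤ 1).trans_lt ENNReal.one_lt_top).ne
  -- The infimum over histories gives a function of the state, which can be compared with the fixed
  -- point.
  let g : S → ℝ≥0∞ := fun x =>
    ⨅ (n : ℕ) (h : (i : Finset.Iic n) → (fun _ : ℕ => S) i) (_ : last h = x),
      σ.after n h (eventuallyAvoid B)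
  have hg : ∀ n (h : (i : Finset.Iic n) → (fun _ : ℕ => S) i),
      g (last h) ≤ σ.after n h (eventuallyAvoid B) := fun n h =>
    iInf_le_of_le n (iInf_le_of_le h (iInf_le _ rfl))
  refine le_trans ?_ (hg n h)
  have := Reach.add_mul_value_le (K := M.law) (l := 1) (T := T) (C := fun x => {τ x}) (g := g)
    (a := 0) (c := δ) (by simp) (fun x hx => ?_) (fun f hf ih x hx => ?_) (last h)
  · simpa using this
  · rw [zero_add]
    refine le_iInf fun n => le_iInf fun h => le_iInf fun hh => ?_
    have h1 : σ.after n h (hitFrom B n) ≤ γ := by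
      refine (σ.after_hitFrom_le (C := fun x => {τ x}) (fun w x f => ?_) B n h).trans
        (hh ▸ hT x hx)
      simp [σ, next_ofChoice]
    have h2 : σ.after n h (hitFrom B n)ᶜ ≤ σ.after n h (eventuallyAvoid B) :=
      measure_mono fun w hw => ⟨n, fun i hi hB => hw ⟨i, hi, hB⟩⟩
    have h3 := measure_add_measure_compl (μ := σ.after n h) (measurableSet_hitFrom B n)
    rw [measure_univ] at h3
    exact (ENNReal.add_le_add_iff_left hγt).1
      ((hγδ.trans h3.symm).le.trans (add_le_add h1 h2))
  · simp only [Set.mem_singleton_iff, iSup_iSup_eq_left, zero_add, one_mul] at ih ⊢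
    refine le_iInf fun n => le_iInf fun h => le_iInf fun hh => ?_
    subst hh
    rw [← PMF.mean_const_mul, σ.after_eq_mean n h (measurableSet_eventuallyAvoid B)]
    refine PMF.mean_mono _ fun y => (ih y).trans ?_
    have := hg (n + 1) (extend h y)
    rwa [last_extend] at this

end Measure

end MDP

/-! ### The parity objective and the conclusion -/

lemma parity_eq_eventuallyAvoid {S : Type*} {col : S → ℕ}
    (hcol : ∀ s, col s ∈ ({0, 1} : Set ℕ)) :
    parity col = MDP.eventuallyAvoid {s | col s ≠ 0} := by
  have hle : ∀ s, col s ≤ 1 := fun s => by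
    rcases hcol s with h | h <;> simp_all
  ext w
  simp only [parity, MDP.eventuallyAvoid, Set.mem_ofPred_eq, not_not]
  constructor
  · rintro ⟨i, h1, h2⟩
    obtain ⟨m, hm⟩ := h1.exists
    have hi : i = 0 := by have := hle (w m); omega
    subst hi
    obtain ⟨n, hn⟩ := eventually_atTop.1 h2
    exact ⟨n, fun i hi => by have := hn i hi; omega⟩
  · rintro ⟨n, hn⟩
    have h : ∀ᶠ m in atTop, col (w m) = 0 := eventually_atTop.2 ⟨n, hn⟩
    exact ⟨0, by simpa using h.frequently, h.mono fun m hm => by simp [hm]⟩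

theorem mainTheorem4 {S : Type*} [Countable S] [MeasurableSpace S] [DiscreteMeasurableSpace S]
    (M : MDP S) (hM : M.FinitelyBranching)
    (col : S → ℕ) (hcol : ∀ s, col s ∈ ({0, 1} : Set ℕ))
    (ε : ℝ) (hε : 0 < ε) :
    ∃ σ : M.Strategy, σ.IsMD ∧ ∀ s : S, σ.IsEpsOptimal (parity col) ε s := by
  -- Three factors `1 - g` are lost: by committing to the safe selector, by near-optimality (with `κ
  -- = δ`), and by the remaining risk of hitting `B`. Together they cost at most `3 * g`.
  obtain ⟨g, hg0, hg1, hgε⟩ : ∃ g : ℝ, 0 < g ∧ g < 1 ∧ 3 * g ≤ ε :=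
    ⟨min ε 1 / 3, by positivity, by linarith [min_le_right ε 1], by linarith [min_le_left ε 1]⟩
  set γ := ENNReal.ofReal g
  set δ := ENNReal.ofReal (1 - g)
  have hγ : γ ≠ 0 := (ENNReal.ofReal_pos.2 hg0).ne'
  have hγ1 : γ ≤ 1 := ENNReal.ofReal_le_one.2 hg1.le
  have hγt : γ ≠ ∞ := ENNReal.ofReal_ne_top
  have hγδ : γ + δ = 1 := by
    rw [← ENNReal.ofReal_add hg0.le (by linarith)]
    simp
  have hδ : δ < 1 := by
    rw [← ENNReal.ofReal_one]
    exact (ENNReal.ofReal_lt_ofReal_iff one_pos).2 (by linarith)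
  rw [parity_eq_eventuallyAvoid hcol]
  set B := {s | col s ≠ 0}
  obtain ⟨b, τ, hτ, hb, hbτ, hval⟩ := Reach.exists_switching_selector (K := M.law) (B := B)
    (C := fun x => {t | M.step x t}) M.exists_step hM hγ hγδ hδ
  refine ⟨.ofChoice τ hτ, MDP.Strategy.isMD_ofChoice τ hτ, fun s => ?_⟩
  set V := Reach.value M.law 1 {x | b x ≤ γ} (fun x => {t | M.step x t}) s
  have hV1 : V ≤ 1 := Reach.value_le_one le_rfl s
  have hVt : V ≠ ∞ := (hV1.trans_lt ENNReal.one_lt_top).ne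
  have hupper : M.value (MDP.eventuallyAvoid B) s ≤ V.toReal := by
    have := MDP.nonempty_strategy M
    exact ciSup_le fun σ => ENNReal.toReal_mono hVt
      (σ.after_eventuallyAvoid_le hM hγ hγ1 hb fun _ => s)
  have hlower : δ * (δ * (δ * V)) ≤
      (MDP.Strategy.ofChoice τ hτ).measure s (MDP.eventuallyAvoid B) := by
    refine le_trans ?_ (MDP.Strategy.le_after_eventuallyAvoid hτ (T := {x | b x ≤ γ * γ}) hγδ
      -- Cancelling `γ` from `γ * value ≤ b x ≤ γ * γ` bounds the risk on the target by `γ`; this is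
      -- why the target threshold is the square.
      (fun x hx => (ENNReal.mul_le_mul_iff_right hγ hγt).1 ((hbτ x).trans hx)) 0 fun _ => s)
    gcongr
    exact hval s
  have hreal := ENNReal.toReal_mono
    (measure_ne_top (μ := MDP.Strategy.after _ 0 fun _ => s) _) hlower
  rw [ENNReal.toReal_mul, ENNReal.toReal_mul, ENNReal.toReal_mul,
    ENNReal.toReal_ofReal (by linarith)] at hreal
  have hv1 : V.toReal ≤ 1 := ENNReal.toReal_le_of_le_ofReal zero_le_one (by simpa using hV1)
  have hv0 : 0 ≤ V.toReal := ENNReal.toReal_nonneg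
  have hcube : 1 - 3 * g ≤ (1 - g) * ((1 - g) * (1 - g)) := by nlinarith [mul_pos hg0 hg0]
  have : V.toReal - ε ≤ (1 - g) * ((1 - g) * ((1 - g) * V.toReal)) := by
    nlinarith [mul_le_mul_of_nonneg_right hcube hv0]
  exact ((sub_le_sub_right hupper ε).trans this).trans hreal
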